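/- Conventions. Let $G$ be a group of permutations of a set $\Omega$. It is \emph{primitive} if it is transitive and the only $G$-invariant equivalence relations on $\Omega$ are the trivial and the universal one. A \emph{subdegree} of $G$ is the cardinality of an orbit of a point stabiliser $G_\alpha$ on $\Omega$. An \emph{orbital digraph} of $G$ is a digraph with vertex set $\Omega$ whose arc set is the orbit $(\alpha,\beta)^G$ of some pair $(\alpha,\beta)\in\Omega\times\Omega$. Two distinct vertices of a digraph are adjacent if there is an arc between them in at least one direction; paths and connectedness are undirected. A digraph is \emph{locally finite} if each vertex is adjacent to only finitely many vertices. The \emph{connectivity} of a connected digraph $\Gamma$ is the least cardinality of a set $W$ of vertices such that the induced digraph $\Gamma\setminus W$ is not connected (the empty digraph being regarded as not connected). A \emph{lobe} of $\Gamma$ is a connected subdigraph that is maximal subject to having connectivity strictly greater than one. A \emph{half-line} is a one-way infinite path without repeated vertices; two half-lines lie in the same \emph{end} if there are infinitely many pairwise disjoint (possibly trivial) paths, each joining a vertex of the first to a vertex of the second. A finite digraph has no ends. If $G$ is primitive and $\Omega$ is infinite, a \emph{canonical orbital digraph} of $G$ is a locally finite orbital digraph of $G$ with connectivity one, each of whose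 lobes has at most one end. We say that a digraph $\Gamma$ is of the form $\Gamma(m,\Lambda)$ if each vertex of $\Gamma$ lies in precisely $m$ distinct lobes, $m$ being a natural number, and $\Lambda$ is a lobe of $\Gamma$. Two canonical orbital digraphs $\Gamma_1,\Gamma_2$ are \emph{equivalent} if $\Gamma_1$ is of the form $\Gamma(m,\Lambda)$ for some $m$ and $\Lambda$, and whenever one of $\Gamma_1,\Gamma_2$ is of the form $\Gamma(m,\Lambda)$, the other is of the form $\Gamma(m,\Lambda')$ for a lobe $\Lambda'$ with the same vertex set as $\Lambda$. Theorem. Let $G$ be a primitive group of permutations of an infinite set $\Omega$ possessing no infinite subdegree. Then any two canonical orbital digraphs of $G$ are equivalent. -/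

import Mathlib

/-!
Orbital digraphs of permutation groups, connectivity, lobes and ends.
A digraph is a `Digraph V`; adjacency, paths, connectedness and ends of a digraph are those of the
associated undirected graph `Γ.toSimpleGraphInclusive` (`v`, `w` adjacent iff `v ≠ w` and at least
one of `(v, w)`, `(w, v)` is an arc).
-/

namespace PermDigraph

open Cardinal

/-- All subdegrees are finite: every orbit of every point stabiliser is finite. -/
def NoInfiniteSubdegree {Ω : Type*} (G : Subgroup (Equiv.Perm Ω)) : Prop :=
  ∀ α β : Ω, (MulAction.orbit (MulAction.stabilizer G α) β).Finite

/-- The orbital digraph of `G` with vertex set `Ω` whose arc set is the `G`-orbit of `(α, β)`. -/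
def orbitalDigraph {Ω : Type*} (G : Subgroup (Equiv.Perm Ω)) (α β : Ω) : Digraph Ω where
  Adj x y := ∃ g ∈ G, g α = x ∧ g β = y

/-- `Γ` is an orbital digraph of `G`. -/
def IsOrbitalDigraph {Ω : Type*} (G : Subgroup (Equiv.Perm Ω)) (Γ : Digraph Ω) : Prop :=
  ∃ α β : Ω, Γ = orbitalDigraph G α β

/-- The subdigraph of `Γ` induced on a set `S` of vertices. -/
def inducedOn {V : Type*} (Γ : Digraph V) (S : Set V) : Digraph S where
  Adj x y := Γ.Adj x y

/-- Connectedness of a digraph (paths are undirected; the empty digraph is not connected). -/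
def IsConnected {V : Type*} (Γ : Digraph V) : Prop :=
  Γ.toSimpleGraphInclusive.Connected

/-- Every vertex is adjacent to only finitely many vertices. -/
def IsLocallyFinite {V : Type*} (Γ : Digraph V) : Prop :=
  ∀ v : V, {w : V | Γ.toSimpleGraphInclusive.Adj v w}.Finite

/-- The connectivity of `Γ`: the smallest cardinality of a set `W` of vertices such that the
digraph `Γ \ W` induced on the complement of `W` is not connected. (The set is non-empty, since
`W` may be the whole vertex set.) -/
noncomputable def connectivity {V : Type*} (Γ : Digraph V) : Cardinal :=
  sInf {κ : Cardinal | ∃ W : Set V, #W = κ ∧ ¬ IsConnected (inducedOn Γ Wᶜ)}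

/-- `S` is the vertex set of a lobe of `Γ`: a connected subdigraph that is maximal subject to having
connectivity strictly greater than one. Such a maximal subdigraph is induced (adding arcs to a
digraph destroys neither connectedness nor connectivity greater than one), hence a lobe is
determined by its vertex set `S`; the lobe itself is `inducedOn Γ S`. -/
def IsLobe {V : Type*} (Γ : Digraph V) (S : Set V) : Prop :=
  Maximal (fun T : Set V => IsConnected (inducedOn Γ T) ∧ 1 < connectivity (inducedOn Γ T)) S

/-- A half-line: a one-way infinite (undirected) path without repeated vertices. -/
structure HalfLine {V : Type*} (Γ : Digraph V) where
  /-- the vertices of the half-line -/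
  vert : ℕ → V
  injective : Function.Injective vert
  adj : ∀ n, Γ.toSimpleGraphInclusive.Adj (vert n) (vert (n + 1))

/-- A (possibly trivial) path from a vertex of `L₁` to a vertex of `L₂`. -/
structure ConnectingPath {V : Type*} {Γ : Digraph V} (L₁ L₂ : HalfLine Γ) where
  /-- index in `L₁` of the initial vertex -/
  i : ℕ
  /-- index in `L₂` of the final vertex -/
  j : ℕ
  /-- the path itself -/
  walk : Γ.toSimpleGraphInclusive.Walk (L₁.vert i) (L₂.vert j)
  isPath : walk.IsPath

/-- Two half-lines lie in the same end if there are infinitely many pairwise disjoint paths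
joining a vertex of the first to a vertex of the second. -/
def SameEnd {V : Type*} {Γ : Digraph V} (L₁ L₂ : HalfLine Γ) : Prop :=
  ∃ P : ℕ → ConnectingPath L₁ L₂,
    ∀ m n : ℕ, m ≠ n → List.Disjoint (P m).walk.support (P n).walk.support

/-- Any two half-lines lie in the same end. In particular a finite digraph, having no half-lines,
satisfies this. -/
def AtMostOneEnd {V : Type*} (Γ : Digraph V) : Prop :=
  ∀ L₁ L₂ : HalfLine Γ, SameEnd L₁ L₂

/-- `Γ` is a canonical orbital digraph of `G` (a primitive group on an infinite set): a locally
finite orbital digraph with connectivity one, each of whose lobes has at most one end. -/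
structure IsCanonicalOrbitalDigraph {Ω : Type*} (G : Subgroup (Equiv.Perm Ω)) (Γ : Digraph Ω) :
    Prop where
  orbital : IsOrbitalDigraph G Γ
  locallyFinite : IsLocallyFinite Γ
  connected : IsConnected Γ
  connectivity_one : connectivity Γ = 1
  lobe_ends : ∀ S : Set Ω, IsLobe Γ S → AtMostOneEnd (inducedOn Γ S)

/-- `Γ` is of the form `Γ(m, Λ)`, where `Λ` is the lobe of `Γ` with vertex set `S`: each vertex lies
in precisely `m` distinct lobes, and `S` is the vertex set of a lobe. -/
def HasForm {V : Type*} (Γ : Digraph V) (m : ℕ) (S : Set V) : Prop :=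
  (∀ v : V, {T : Set V | IsLobe Γ T ∧ v ∈ T}.encard = m) ∧ IsLobe Γ S

/-- `Γ₁` can be written as `Γ(m, Λ)`, and whenever one of the two digraphs is written as `Γ(m, Λ)`,
the other one is `Γ(m, Λ')` for a lobe `Λ'` with the same vertex set as `Λ`. -/
def Equivalent {V : Type*} (Γ₁ Γ₂ : Digraph V) : Prop :=
  (∃ (m : ℕ) (S : Set V), HasForm Γ₁ m S) ∧
    ∀ (m : ℕ) (S : Set V), HasForm Γ₁ m S ↔ HasForm Γ₂ m S

end PermDigraph

/-! Everything rests on one relation: `JoinedOff A u x y`, saying that the vertex `u` does not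
separate `x` from `y`. Lobes of a connected digraph are the maximal sets of at least two vertices
that no vertex separates (`isLobe_iff`), so it suffices that both canonical digraphs have the same
separation relation (`JoinedOff.of_canonical`). Let `S` be a lobe of `Γ₂` and `c ∈ S`. Finiteness of
subdegrees lets only finitely many edges of `Γ₂` run between different components of `Γ₁ \ c`
(`finite_crossing`). As `S` has at most one end, almost all of `S` lies in one component. The
setwise stabiliser of `S` is transitive on `S`, and a descent on the number of exceptions shows that
`S \ {c}` lies in a single component (`joinedOff_of_mem_block`). So each lobe of `Γ₂` at `u` selects
a lobe of `Γ₁` at `u`. This map is onto because the stabiliser of `u` permutes the lobes at `u`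
transitively; by symmetry and finiteness it is bijective, so distinct lobes of `Γ₂` at `u` lie in
distinct components of `Γ₁ \ u` (`block_eq_of_joinedOff`). Induction on distance in `Γ₂` extends
this to all separated pairs. -/

namespace PermDigraph

open Cardinal

/-! ### Separation by a vertex, and blocks of a graph. -/

section Graph

variable {V : Type*} {A : SimpleGraph V}

/-- `x` and `y` are joined by a walk of `A` that avoids `u`. -/
def JoinedOff (A : SimpleGraph V) (u x y : V) : Prop := ∃ p : A.Walk x y, u ∉ p.support

theorem JoinedOff.refl {u x : V} (h : x ≠ u) : JoinedOff A u x x := ⟨.nil, by simpa using h.symm⟩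

theorem JoinedOff.symm {u x y : V} : JoinedOff A u x y → JoinedOff A u y x := by
  rintro ⟨p, hp⟩
  exact ⟨p.reverse, by simpa using hp⟩

theorem JoinedOff.trans {u x y z : V} :
    JoinedOff A u x y → JoinedOff A u y z → JoinedOff A u x z := by
  rintro ⟨p, hp⟩ ⟨q, hq⟩
  exact ⟨p.append q, by simp [SimpleGraph.Walk.mem_support_append_iff, hp, hq]⟩

theorem JoinedOff.of_adj {u x y : V} (h : A.Adj x y) (hx : x ≠ u) (hy : y ≠ u) :
    JoinedOff A u x y :=
  ⟨.cons h .nil, by simp [hx.symm, hy.symm]⟩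

theorem JoinedOff.ne_left {u x y : V} : JoinedOff A u x y → x ≠ u := by
  rintro ⟨p, hp⟩ rfl
  exact hp p.start_mem_support

theorem JoinedOff.ne_right {u x y : V} (h : JoinedOff A u x y) : y ≠ u := h.symm.ne_left

/-- If `u` lies on every walk from `x` to `y`, then the part of a path beyond `u` avoids `x`. -/
theorem JoinedOff.exchange (hA : A.Connected) {u x y : V} (hx : x ≠ u)
    (h : ¬ JoinedOff A u x y) : JoinedOff A x u y := by
  classical
  obtain ⟨p, hp⟩ := (hA x y).exists_isPath
  have hu : u ∈ p.support := by
    by_contra hu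
    exact h ⟨p, hu⟩
  refine ⟨p.dropUntil u hu, fun hmem => ?_⟩
  rw [← p.take_spec hu] at hp
  exact SimpleGraph.Walk.IsPath.ne_of_mem_support_of_append hp
    hx (p.takeUntil u hu).start_mem_support hmem rfl

/-- No vertex separates two members of `T`. -/
def Inseparable (A : SimpleGraph V) (T : Set V) : Prop :=
  ∀ ⦃u x y⦄, x ∈ T → y ∈ T → x ≠ u → y ≠ u → JoinedOff A u x y

/-- Maximal inseparable sets with at least two vertices. -/
def IsBlockSet (A : SimpleGraph V) (T : Set V) : Prop :=
  Maximal (fun T : Set V => T.Nontrivial ∧ Inseparable A T) T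

/-- The vertices that no single vertex separates from `a` or from `b`. -/
def blockThrough (A : SimpleGraph V) (a b : V) : Set V :=
  {z | ∀ u, z ≠ u → (a ≠ u → JoinedOff A u a z) ∧ (b ≠ u → JoinedOff A u b z)}

/-- A vertex `u` cannot equal both `a` and `b`; the other one serves as a relay between `x` and `y`.
-/
theorem inseparable_blockThrough {a b : V} (hab : a ≠ b) : Inseparable A (blockThrough A a b) := by
  intro u x y hx hy hxu hyu
  by_cases hau : a = u
  · have hbu : b ≠ u := fun h => hab (hau.trans h.symm)
    exact ((hx u hxu).2 hbu).symm.trans ((hy u hyu).2 hbu)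
  · exact ((hx u hxu).1 hau).symm.trans ((hy u hyu).1 hau)

theorem Inseparable.subset_blockThrough {T : Set V} (hT : Inseparable A T) {a b : V} (ha : a ∈ T)
    (hb : b ∈ T) : T ⊆ blockThrough A a b :=
  fun _ hz _ hzu => ⟨fun hau => hT ha hz hau hzu, fun hbu => hT hb hz hbu hzu⟩

/-- Every inseparable set containing `a` and `b` lies in `blockThrough A a b`, so two distinct
vertices determine their block. -/
theorem Inseparable.isBlockSet_blockThrough {T : Set V} (hT : Inseparable A T) {a b : V}
    (ha : a ∈ T) (hb : b ∈ T) (hab : a ≠ b) : IsBlockSet A (blockThrough A a b) := by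
  have hsub := hT.subset_blockThrough ha hb
  exact ⟨⟨⟨a, hsub ha, b, hsub hb, hab⟩, inseparable_blockThrough hab⟩, fun T' hT' h =>
    hT'.2.subset_blockThrough (h (hsub ha)) (h (hsub hb))⟩

theorem IsBlockSet.eq_blockThrough {T : Set V} (hT : IsBlockSet A T) {a b : V} (ha : a ∈ T)
    (hb : b ∈ T) (hab : a ≠ b) : T = blockThrough A a b :=
  hT.eq_of_subset (hT.1.2.isBlockSet_blockThrough ha hb hab).1 (hT.1.2.subset_blockThrough ha hb)

theorem IsBlockSet.eq_of_mem {S T : Set V} (hS : IsBlockSet A S) (hT : IsBlockSet A T) {a b : V}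
    (haS : a ∈ S) (hbS : b ∈ S) (haT : a ∈ T) (hbT : b ∈ T) (hab : a ≠ b) : S = T := by
  rw [hS.eq_blockThrough haS hbS hab, hT.eq_blockThrough haT hbT hab]

theorem inseparable_pair {a b : V} (h : ∀ u, a ≠ u → b ≠ u → JoinedOff A u a b) :
    Inseparable A {a, b} := by
  rintro u x y (rfl | rfl) (rfl | rfl) hx hy
  · exact .refl hx
  · exact h u hx hy
  · exact (h u hy hx).symm
  · exact .refl hx

theorem exists_isBlockSet {a b : V} (hab : a ≠ b)
    (h : ∀ u, a ≠ u → b ≠ u → JoinedOff A u a b) : ∃ T, IsBlockSet A T ∧ a ∈ T ∧ b ∈ T := by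
  have hI := inseparable_pair h
  have hs := hI.subset_blockThrough (a := a) (b := b) (by simp) (by simp)
  exact ⟨_, hI.isBlockSet_blockThrough (by simp) (by simp) hab, hs (by simp), hs (by simp)⟩

theorem exists_isBlockSet_of_adj {a b : V} (h : A.Adj a b) :
    ∃ T, IsBlockSet A T ∧ a ∈ T ∧ b ∈ T :=
  exists_isBlockSet h.ne fun _ ha hb => .of_adj h ha hb

/-- Two blocks containing `u` that meet the same component off `u` are equal. -/
theorem IsBlockSet.eq_of_joinedOff {S T : Set V} (hS : IsBlockSet A S) (hT : IsBlockSet A T)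
    {u x y : V} (huS : u ∈ S) (huT : u ∈ T) (hx : x ∈ S) (hy : y ∈ T) (h : JoinedOff A u x y) :
    S = T := by
  have key : Inseparable A (S ∪ T) := by
    -- The relay is the common vertex `u`, unless `u` itself is deleted; then it is the given walk
    -- from `x` to `y`.
    have cross : ∀ ⦃c a b⦄, a ∈ S → b ∈ T → a ≠ c → b ≠ c → JoinedOff A c a b := by
      intro c a b ha hb hac hbc
      by_cases huc : u = c
      · subst huc
        exact ((hS.1.2 ha hx hac h.ne_left).trans h).trans (hT.1.2 hy hb h.ne_right hbc)
      · exact (hS.1.2 ha huS hac huc).trans (hT.1.2 huT hb huc hbc)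
    rintro c a b (ha | ha) (hb | hb) hac hbc
    · exact hS.1.2 ha hb hac hbc
    · exact cross ha hb hac hbc
    · exact (cross hb ha hbc hac).symm
    · exact hT.1.2 ha hb hac hbc
  have h1 := hS.eq_of_subset ⟨hS.1.1.mono Set.subset_union_left, key⟩ Set.subset_union_left
  have h2 := hT.eq_of_subset ⟨hT.1.1.mono Set.subset_union_right, key⟩ Set.subset_union_right
  exact h1.trans h2.symm

/-- A path with both ends in a block stays in the block. -/
theorem IsBlockSet.support_subset {T : Set V} (hT : IsBlockSet A T) {x y : V} (hx : x ∈ T)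
    (hy : y ∈ T) (p : A.Walk x y) (hp : p.IsPath) : ∀ z ∈ p.support, z ∈ T := by
  classical
  -- `c` occurs at most once on the path, so it misses the part before `z` or the part after it.
  have reach : ∀ ⦃c z⦄, z ∈ p.support → z ≠ c → ∃ e ∈ T, e ≠ c ∧ JoinedOff A c z e := by
    intro c z hz hzc
    by_cases hc : c ∈ (p.takeUntil z hz).support
    · have : c ∉ (p.dropUntil z hz).support := fun hc' => by
        rw [← p.take_spec hz] at hp
        exact SimpleGraph.Walk.IsPath.ne_of_mem_support_of_append hp hzc.symm hc hc' rfl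
      have hj : JoinedOff A c z y := ⟨_, this⟩
      exact ⟨y, hy, hj.ne_right, hj⟩
    · have hj : JoinedOff A c x z := ⟨_, hc⟩
      exact ⟨x, hx, hj.ne_left, hj.symm⟩
  have key : Inseparable A (T ∪ {z | z ∈ p.support}) := by
    have all : ∀ ⦃c z⦄, z ∈ T ∪ {z | z ∈ p.support} → z ≠ c →
        ∃ e ∈ T, e ≠ c ∧ JoinedOff A c z e := by
      rintro c z (hz | hz) hzc
      · exact ⟨z, hz, hzc, .refl hzc⟩
      · exact reach hz hzc
    intro c a b ha hb hac hbc
    obtain ⟨e, he, hec, hae⟩ := all ha hac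
    obtain ⟨f, hf, hfc, hbf⟩ := all hb hbc
    exact (hae.trans (hT.1.2 he hf hec hfc)).trans hbf.symm
  have h1 := hT.eq_of_subset ⟨hT.1.1.mono Set.subset_union_left, key⟩ Set.subset_union_left
  intro z hz
  rw [h1]
  exact Or.inr hz

theorem joinedOff_of_induce {T : Set V} {u : V} (hu : u ∉ T) {x y : T}
    (h : (A.induce T).Reachable x y) : JoinedOff A u x y := by
  obtain ⟨p⟩ := h
  let f : A.induce T →g A := (SimpleGraph.Embedding.induce T).toHom
  suffices h : JoinedOff A u (f x) (f y) from h
  refine ⟨p.map f, fun h => ?_⟩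
  rw [SimpleGraph.Walk.support_map, List.mem_map] at h
  obtain ⟨z, -, rfl⟩ := h
  exact hu z.2

theorem Inseparable.of_induce_connected {T : Set V} (h : (A.induce T).Connected)
    (h' : ∀ u ∈ T, (A.induce (T \ {u})).Connected) : Inseparable A T := by
  intro u x y hx hy hxu hyu
  by_cases hu : u ∈ T
  · exact joinedOff_of_induce (T := T \ {u}) (by simp)
      ((h' u hu).preconnected ⟨x, hx, hxu⟩ ⟨y, hy, hyu⟩)
  · exact joinedOff_of_induce hu (h.preconnected ⟨x, hx⟩ ⟨y, hy⟩)

theorem IsBlockSet.induce_connected {T : Set V} (hT : IsBlockSet A T) (hA : A.Connected) :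
    (A.induce T).Connected := by
  have : Nonempty T := hT.1.1.nonempty.to_subtype
  refine ⟨fun x y => ?_⟩
  obtain ⟨p, hp⟩ := (hA x y).exists_isPath
  exact ⟨p.induce T (hT.support_subset x.2 y.2 p hp)⟩

theorem IsBlockSet.induce_diff_connected {T : Set V} (hT : IsBlockSet A T) (u : V) :
    (A.induce (T \ {u})).Connected := by
  classical
  obtain ⟨a, ha, hau⟩ := hT.1.1.exists_ne u
  have : Nonempty (T \ {u} : Set V) := ⟨⟨a, ha, hau⟩⟩
  refine ⟨fun x y => ?_⟩
  obtain ⟨p, hp⟩ := hT.1.2 x.2.1 y.2.1 x.2.2 y.2.2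
  refine ⟨p.bypass.induce (T \ {u}) fun z hz =>
    ⟨hT.support_subset x.2.1 y.2.1 _ p.bypass_isPath z hz, ?_⟩⟩
  rintro rfl
  exact hp (p.support_bypass_subset_support hz)

/-- Blocks are the maximal vertex sets inducing a connected subgraph without cut vertices. -/
theorem isBlockSet_iff_maximal (hA : A.Connected) (S : Set V) : IsBlockSet A S ↔
    Maximal (fun T : Set V => (A.induce T).Connected ∧
      ∀ u ∈ T, (A.induce (T \ {u})).Connected) S := by
  have h1 : ∀ T : Set V, ((A.induce T).Connected ∧ ∀ u ∈ T, (A.induce (T \ {u})).Connected) →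
      T.Nontrivial ∧ Inseparable A T := by
    rintro T ⟨h, h'⟩
    refine ⟨?_, .of_induce_connected h h'⟩
    obtain ⟨a⟩ := h.nonempty
    obtain ⟨b⟩ := (h' a a.2).nonempty
    exact ⟨b, b.2.1, a, a.2, b.2.2⟩
  have h2 : ∀ T : Set V, IsBlockSet A T → ((A.induce T).Connected ∧
      ∀ u ∈ T, (A.induce (T \ {u})).Connected) :=
    fun T hT => ⟨hT.induce_connected hA, fun u _ => hT.induce_diff_connected u⟩
  constructor
  · exact fun h => ⟨h2 S h, fun T hT hST => h.2 (h1 T hT) hST⟩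
  · intro h
    obtain ⟨⟨a, ha, b, hb, hab⟩, hI⟩ := h1 S h.1
    have hB := hI.isBlockSet_blockThrough ha hb hab
    rwa [h.eq_of_subset (h2 _ hB) (hI.subset_blockThrough ha hb)]

theorem JoinedOff.map {u x y : V} (g : A ≃g A) (h : JoinedOff A u x y) :
    JoinedOff A (g u) (g x) (g y) := by
  obtain ⟨p, hp⟩ := h
  refine ⟨p.map g.toHom, fun hu => ?_⟩
  rw [SimpleGraph.Walk.support_map, List.mem_map] at hu
  obtain ⟨z, hz, hzu⟩ := hu
  exact hp (g.injective hzu ▸ hz)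

theorem Inseparable.image {T : Set V} (g : A ≃g A) (h : Inseparable A T) :
    Inseparable A (g '' T) := by
  rintro u _ _ ⟨x, hx, rfl⟩ ⟨y, hy, rfl⟩ hxu hyu
  have := (h (u := g.symm u) hx hy (fun e => hxu (by simp [e])) (fun e => hyu (by simp [e]))).map g
  simpa using this

theorem IsBlockSet.image {T : Set V} (g : A ≃g A) (h : IsBlockSet A T) : IsBlockSet A (g '' T) := by
  refine ⟨⟨h.1.1.image g.injective, h.1.2.image g⟩, fun T' hT' hsub z hz => ?_⟩
  have h1 : T ⊆ g.symm '' T' := fun x hx => ⟨g x, hsub ⟨x, hx, rfl⟩, by simp⟩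
  have h2 := h.2 ⟨hT'.1.image g.symm.injective, hT'.2.image g.symm⟩ h1 ⟨z, hz, rfl⟩
  exact ⟨_, h2, by simp⟩

/-- Every vertex `x ≠ u` is joined off `u` to a neighbour of `u`. -/
theorem exists_adj_joinedOff (hA : A.Connected) {u x : V} (h : x ≠ u) :
    ∃ n, A.Adj u n ∧ JoinedOff A u n x := by
  obtain ⟨p, hp⟩ := (hA u x).exists_isPath
  cases p with
  | nil => exact absurd rfl h
  | cons hn q =>
    rw [SimpleGraph.Walk.cons_isPath_iff] at hp
    exact ⟨_, hn, q, hp.2⟩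

theorem IsBlockSet.exists_adj {T : Set V} (hT : IsBlockSet A T) (hA : A.Connected) {u : V}
    (hu : u ∈ T) : ∃ n ∈ T, A.Adj u n := by
  have : Nontrivial T := hT.1.1.coe_sort
  obtain ⟨n, hn⟩ := (hT.induce_connected hA).preconnected.exists_adj_of_nontrivial ⟨u, hu⟩
  exact ⟨n, n.2, hn⟩

/-- Each block at `u` contains a neighbour of `u`, and that neighbour determines the block. -/
theorem finite_isBlockSet_mem (hA : A.Connected) {u : V} (hf : {n | A.Adj u n}.Finite) :
    {T | IsBlockSet A T ∧ u ∈ T}.Finite := by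
  have : ∀ T : {T | IsBlockSet A T ∧ u ∈ T}, ∃ n : {n | A.Adj u n}, n.1 ∈ T.1 := fun T =>
    let ⟨n, hn, h⟩ := T.2.1.exists_adj hA T.2.2
    ⟨⟨n, h⟩, hn⟩
  choose f hfm using this
  have := hf.to_subtype
  have hinj : Function.Injective f := fun S T h => Subtype.ext <|
    S.2.1.eq_of_mem T.2.1 S.2.2 (hfm S) T.2.2 (h ▸ hfm T) (f S).2.ne
  exact Set.finite_coe_iff.1 (Finite.of_injective f hinj)
end Graph

/-! ### Lobes are blocks. -/

section Lobes

theorem one_lt_connectivity_iff {V : Type*} (Γ : Digraph V) :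
    1 < connectivity Γ ↔ ∀ W : Set V, W.Subsingleton → IsConnected (inducedOn Γ Wᶜ) := by
  constructor
  · intro h W hW
    by_contra hc
    have h1 : connectivity Γ ≤ #W := csInf_le' ⟨W, rfl, hc⟩
    exact absurd (h.trans_le h1) (not_lt.2 (mk_le_one_iff_set_subsingleton.2 hW))
  · intro h
    have hne : {κ : Cardinal | ∃ W : Set V, #W = κ ∧ ¬ IsConnected (inducedOn Γ Wᶜ)}.Nonempty :=
      ⟨_, Set.univ, rfl, fun hc => by
        obtain ⟨x, hx⟩ := hc.nonempty
        exact hx trivial⟩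
    obtain ⟨W, hW, hc⟩ := csInf_mem hne
    rw [connectivity, ← hW]
    by_contra hlt
    exact hc (h W (mk_le_one_iff_set_subsingleton.1 (not_lt.1 hlt)))

theorem inducedOn_toSimpleGraphInclusive {V : Type*} (Γ : Digraph V) (T : Set V) :
    (inducedOn Γ T).toSimpleGraphInclusive = Γ.toSimpleGraphInclusive.induce T := by
  ext x y
  simp [Digraph.toSimpleGraphInclusive, inducedOn, Subtype.ext_iff]

theorem isConnected_inducedOn_inducedOn {V : Type*} (Γ : Digraph V) (T U : Set V) (W : Set T)
    (h : ∀ x, x ∈ U ↔ ∃ hx : x ∈ T, (⟨x, hx⟩ : T) ∈ W) :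
    IsConnected (inducedOn (inducedOn Γ T) W) ↔ (Γ.toSimpleGraphInclusive.induce U).Connected := by
  rw [IsConnected, inducedOn_toSimpleGraphInclusive, inducedOn_toSimpleGraphInclusive]
  let e : W ≃ U :=
    { toFun := fun x => ⟨x.1.1, (h _).2 ⟨x.1.2, x.2⟩⟩
      invFun := fun x => ⟨⟨x.1, ((h _).1 x.2).1⟩, ((h _).1 x.2).2⟩
      left_inv := fun _ => rfl
      right_inv := fun _ => rfl }
  exact SimpleGraph.Iso.connected_iff ⟨e, Iff.rfl⟩

/-- Connectivity above one means that deleting at most one vertex leaves a connected digraph. As the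
empty digraph is not connected, a single vertex does not qualify, which matches the requirement of
two vertices in `IsBlockSet`. -/
theorem isLobe_iff {V : Type*} {Γ : Digraph V} (hΓ : IsConnected Γ) (S : Set V) :
    IsLobe Γ S ↔ IsBlockSet Γ.toSimpleGraphInclusive S := by
  rw [isBlockSet_iff_maximal hΓ, IsLobe]
  suffices h : (fun T : Set V => IsConnected (inducedOn Γ T) ∧ 1 < connectivity (inducedOn Γ T)) =
      fun T : Set V => (Γ.toSimpleGraphInclusive.induce T).Connected ∧
        ∀ u ∈ T, (Γ.toSimpleGraphInclusive.induce (T \ {u})).Connected by rw [h]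
  funext T
  rw [one_lt_connectivity_iff, IsConnected, inducedOn_toSimpleGraphInclusive]
  refine propext (and_congr_right fun hT => ⟨fun h u hu => ?_, fun h W hW => ?_⟩)
  · refine (isConnected_inducedOn_inducedOn Γ T _ _ fun x => ?_).1
      (h {⟨u, hu⟩} Set.subsingleton_singleton)
    simp [Subtype.ext_iff]
  · rcases hW.eq_empty_or_singleton with rfl | ⟨⟨u, hu⟩, rfl⟩
    · exact (isConnected_inducedOn_inducedOn Γ T T _ fun x => by simp).2 hT
    · exact (isConnected_inducedOn_inducedOn Γ T _ _ fun x => by simp [Subtype.ext_iff]).2 (h u hu)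

end Lobes

/-! ### Kőnig's lemma and sets with finite boundary. -/

section Rays

variable {V : Type*} {H : SimpleGraph V}

/-- Kőnig's lemma: an infinite, connected, locally finite graph contains a one-way infinite path. -/
theorem exists_ray_of_connected [Infinite V] (hH : H.Connected)
    (hf : ∀ v, {w | H.Adj v w}.Finite) :
    ∃ f : ℕ → V, Function.Injective f ∧ ∀ n, H.Adj (f n) (f (n + 1)) := by
  obtain ⟨r⟩ := hH.nonempty
  -- `D v` consists of the `w` reached from `r` by a geodesic through `v`. If it is infinite, so is
  -- `D n` for some neighbour `n` of `v` one step further from `r`; increasing distance makes the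
  -- ray injective.
  let D : V → Set V := fun v => {w | H.dist r w = H.dist r v + H.dist v w}
  have step : ∀ v : {v // (D v).Infinite}, ∃ w : {v // (D v).Infinite},
      H.Adj v w ∧ H.dist r w = H.dist r v + 1 := by
    rintro ⟨v, hv⟩
    have hcov : D v ⊆ {v} ∪ ⋃ n ∈ {n | H.Adj v n}, {w | H.dist r n = H.dist r v + 1 ∧ w ∈ D n} := by
      intro w hw
      by_cases hwv : w = v
      · exact Or.inl hwv
      · right
        obtain ⟨p, hp⟩ := (hH v w).exists_walk_length_eq_dist
        cases p with
        | nil => exact absurd rfl hwv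
        | @cons _ n _ hn q =>
          simp only [Set.mem_iUnion]
          have h1 : H.dist n w ≤ q.length := SimpleGraph.dist_le q
          have h2 : H.dist r w ≤ H.dist r n + H.dist n w := hH.dist_triangle
          have h3 : H.dist r n ≤ H.dist r v + H.dist v n := hH.dist_triangle
          have h4 : H.dist v n = 1 := SimpleGraph.dist_eq_one_iff_adj.2 hn
          have h5 : H.dist r w = H.dist r v + H.dist v w := hw
          rw [SimpleGraph.Walk.length_cons] at hp
          refine ⟨n, hn, by omega, ?_⟩
          change H.dist r w = H.dist r n + H.dist n w
          omega
    by_contra hno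
    push Not at hno
    refine hv (((Set.finite_singleton v).union ((hf v).biUnion fun n hn => ?_)).subset hcov)
    by_cases hd : H.dist r n = H.dist r v + 1
    · have hfin : (D n).Finite := by
        by_contra hinf
        exact hno ⟨n, hinf⟩ hn hd
      exact hfin.subset fun w hw => hw.2
    · exact Set.finite_empty.subset fun w hw => hd hw.1
  choose nxt hadj hdist using step
  have hr : (D r).Infinite := by
    have : D r = Set.univ := by ext w; simp [D]
    rw [this]
    exact Set.infinite_univ
  let s : ℕ → {v // (D v).Infinite} := fun n => Nat.rec ⟨r, hr⟩ (fun _ v => nxt v) n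
  have hs : ∀ n, H.dist r (s n).1 = n := by
    intro n
    induction n with
    | zero => simp [s]
    | succ n ih => exact (hdist (s n)).trans (by rw [ih])
  refine ⟨fun n => (s n).1, fun m n h => ?_, fun n => hadj (s n)⟩
  rw [← hs m, ← hs n]
  exact congrArg (H.dist r) h

theorem exists_ray_of_finite_reachable [Infinite V] (hf : ∀ v, {w | H.Adj v w}.Finite)
    {F : Set V} (hF : F.Finite) (hr : ∀ v, ∃ f ∈ F, H.Reachable v f) :
    ∃ f : ℕ → V, Function.Injective f ∧ ∀ n, H.Adj (f n) (f (n + 1)) := by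
  have hex : ∃ f ∈ F, {v | H.Reachable v f}.Infinite := by
    by_contra hno
    push Not at hno
    refine Set.infinite_univ (α := V) ((hF.biUnion hno).subset fun v _ => ?_)
    simpa using hr v
  obtain ⟨f, -, hinf⟩ := hex
  let C := H.connectedComponentMk f
  have hC : {v | H.Reachable v f} = C.supp := by
    ext v
    simp [C, SimpleGraph.ConnectedComponent.mem_supp_iff, SimpleGraph.ConnectedComponent.eq]
  rw [hC] at hinf
  have : Infinite C.supp := hinf.to_subtype
  obtain ⟨s, hs, hs'⟩ := exists_ray_of_connected (H := H.induce C.supp)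
    C.connected_toSimpleGraph
    (fun v => Set.Finite.preimage Subtype.val_injective.injOn (hf v))
  exact ⟨fun n => s n, Subtype.val_injective.comp hs, hs'⟩

/-- In a connected graph, every vertex of `X` is joined inside `X` to a vertex of the boundary. -/
theorem exists_boundary_reachable (hH : H.Connected) {X : Set V} {y : V} (hy : y ∉ X) (x : X) :
    ∃ f : X, (∃ w, w ∉ X ∧ H.Adj f w) ∧ (H.induce X).Reachable x f := by
  obtain ⟨p⟩ := hH x y
  obtain ⟨x, hx⟩ := x
  simp only at p
  induction p with
  | nil => exact absurd hx hy
  | @cons a b c hab q ih =>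
    by_cases hb : b ∈ X
    · obtain ⟨f, hf, hr⟩ := ih hy hb
      exact ⟨f, hf, (SimpleGraph.Adj.reachable (by exact hab)).trans hr⟩
    · exact ⟨⟨a, hx⟩, ⟨b, hb, hab⟩, .refl _⟩

/-- An infinite vertex set with finite boundary contains a one-way infinite path. -/
theorem exists_ray_mem (hH : H.Connected) (hf : ∀ v, {w | H.Adj v w}.Finite) {X : Set V}
    (hX : X.Infinite) {y : V} (hy : y ∉ X) (hF : {x | x ∈ X ∧ ∃ w, w ∉ X ∧ H.Adj x w}.Finite) :
    ∃ f : ℕ → V, Function.Injective f ∧ (∀ n, H.Adj (f n) (f (n + 1))) ∧ ∀ n, f n ∈ X := by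
  have := hX.to_subtype
  obtain ⟨s, hs, hs'⟩ := exists_ray_of_finite_reachable (H := H.induce X)
    (F := Subtype.val ⁻¹' {x | x ∈ X ∧ ∃ w, w ∉ X ∧ H.Adj x w})
    (fun v => Set.Finite.preimage Subtype.val_injective.injOn (hf v))
    (hF.preimage Subtype.val_injective.injOn)
    (fun v => by
      obtain ⟨f, hw, hr⟩ := exists_boundary_reachable hH hy v
      exact ⟨f, ⟨f.2, hw⟩, hr⟩)
  exact ⟨fun n => s n, Subtype.val_injective.comp hs, hs', fun n => (s n).2⟩

theorem exists_mem_support_boundary {X : Set V} {x y : V} (p : H.Walk x y) (hx : x ∈ X)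
    (hy : y ∉ X) : ∃ z ∈ p.support, z ∈ X ∧ ∃ w, w ∉ X ∧ H.Adj z w := by
  induction p with
  | nil => exact absurd hx hy
  | @cons a b c hab q ih =>
    by_cases hb : b ∈ X
    · obtain ⟨z, hz, h⟩ := ih hb hy
      exact ⟨z, by simp [hz], h⟩
    · exact ⟨a, by simp, hx, b, hb, hab⟩

/-- In a locally finite connected digraph with at most one end, no vertex set that is infinite
and co-infinite has finite boundary. -/
theorem AtMostOneEnd.finite_or_finite_compl {Γ : Digraph V} (hE : AtMostOneEnd Γ)
    (hc : IsConnected Γ) (hf : IsLocallyFinite Γ) {X : Set V}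
    (hF : {x | ∃ w, (x ∈ X ↔ w ∉ X) ∧ Γ.toSimpleGraphInclusive.Adj x w}.Finite) :
    X.Finite ∨ Xᶜ.Finite := by
  by_contra hno
  obtain ⟨hX, hY⟩ := not_or.1 hno
  obtain ⟨y, hy⟩ := Set.Infinite.nonempty hY
  obtain ⟨x, hx⟩ := Set.Infinite.nonempty hX
  obtain ⟨f, hfi, hfa, hfX⟩ := exists_ray_mem hc hf hX hy
    (hF.subset fun z ⟨hz, w, hw, h⟩ => ⟨w, by simp [hz, hw], h⟩)
  obtain ⟨g, hgi, hga, hgX⟩ := exists_ray_mem hc hf hY (y := x) (by simpa using hx)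
    (hF.subset fun z ⟨hz, w, hw, h⟩ => ⟨w, by simp_all, h⟩)
  obtain ⟨P, hP⟩ := hE ⟨f, hfi, hfa⟩ ⟨g, hgi, hga⟩
  -- Each connecting path leaves `X`, hence meets the finite boundary; disjoint paths meet it in
  -- different vertices.
  have hz : ∀ n, ∃ z ∈ (P n).walk.support,
      z ∈ {x | ∃ w, (x ∈ X ↔ w ∉ X) ∧ Γ.toSimpleGraphInclusive.Adj x w} := by
    intro n
    obtain ⟨z, hz, hzX, w, hw, h⟩ := exists_mem_support_boundary (X := X) (P n).walk
      (hfX (P n).i) (hgX (P n).j)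
    exact ⟨z, hz, w, by simp [hzX, hw], h⟩
  choose z hz hzF using hz
  have hinj : Function.Injective z := fun m n h => by
    by_contra hmn
    exact hP m n hmn (hz m) (h ▸ hz n)
  exact Set.infinite_range_of_injective hinj (hF.subset (Set.range_subset_iff.2 hzF))

end Rays

/-! ### Transitivity on and among the blocks of an orbital digraph. -/

section Orbital

variable {Ω : Type*} {G : Subgroup (Equiv.Perm Ω)} {Γ : Digraph Ω}

theorem IsOrbitalDigraph.adj_apply (h : IsOrbitalDigraph G Γ) {g : Equiv.Perm Ω} (hg : g ∈ G)
    {x y : Ω} (hxy : Γ.Adj x y) : Γ.Adj (g x) (g y) := by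
  obtain ⟨α, β, rfl⟩ := h
  obtain ⟨k, hk, rfl, rfl⟩ := hxy
  exact ⟨g * k, G.mul_mem hg hk, rfl, rfl⟩

theorem IsOrbitalDigraph.exists_of_adj (h : IsOrbitalDigraph G Γ) {x y x' y' : Ω}
    (hxy : Γ.Adj x y) (hxy' : Γ.Adj x' y') : ∃ g ∈ G, g x = x' ∧ g y = y' := by
  obtain ⟨α, β, rfl⟩ := h
  obtain ⟨k, hk, rfl, rfl⟩ := hxy
  obtain ⟨l, hl, rfl, rfl⟩ := hxy'
  exact ⟨l * k⁻¹, G.mul_mem hl (G.inv_mem hk), by simp, by simp⟩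

theorem IsOrbitalDigraph.exists_iso (h : IsOrbitalDigraph G Γ) {g : Equiv.Perm Ω} (hg : g ∈ G) :
    ∃ φ : Γ.toSimpleGraphInclusive ≃g Γ.toSimpleGraphInclusive, ∀ x, φ x = g x := by
  have key : ∀ {x y}, Γ.Adj (g x) (g y) ↔ Γ.Adj x y := fun {x y} =>
    ⟨fun hxy => by simpa using h.adj_apply (G.inv_mem hg) hxy, h.adj_apply hg⟩
  refine ⟨⟨g, ?_⟩, fun _ => rfl⟩
  intro x y
  simp [Digraph.toSimpleGraphInclusive, key]

theorem IsOrbitalDigraph.joinedOff_apply (h : IsOrbitalDigraph G Γ) {g : Equiv.Perm Ω}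
    (hg : g ∈ G) {u x y : Ω} (hj : JoinedOff Γ.toSimpleGraphInclusive u x y) :
    JoinedOff Γ.toSimpleGraphInclusive (g u) (g x) (g y) := by
  obtain ⟨φ, hφ⟩ := h.exists_iso hg
  simpa only [hφ] using hj.map φ

theorem IsOrbitalDigraph.isBlockSet_image (h : IsOrbitalDigraph G Γ) {g : Equiv.Perm Ω}
    (hg : g ∈ G) {T : Set Ω} (hT : IsBlockSet Γ.toSimpleGraphInclusive T) :
    IsBlockSet Γ.toSimpleGraphInclusive (g '' T) := by
  obtain ⟨φ, hφ⟩ := h.exists_iso hg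
  simpa only [hφ] using hT.image φ

theorem IsOrbitalDigraph.ne_of_adj [Nontrivial Ω] (h : IsOrbitalDigraph G Γ) (hc : IsConnected Γ)
    {x y : Ω} (hxy : Γ.Adj x y) : x ≠ y := by
  obtain ⟨w, hne, hw⟩ := hc.preconnected.exists_adj_of_nontrivial x
  rintro rfl
  rcases hw with hw | hw
  · obtain ⟨g, -, h1, h2⟩ := h.exists_of_adj hxy hw
    exact hne (h1.symm.trans h2)
  · obtain ⟨g, -, h1, h2⟩ := h.exists_of_adj hxy hw
    exact hne (h2.symm.trans h1)

/-- An element of `G` mapping an arc of one block to an arc of another maps the first block to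
the second. -/
theorem IsOrbitalDigraph.exists_image_eq [Nontrivial Ω] (h : IsOrbitalDigraph G Γ)
    (hc : IsConnected Γ) {S T : Set Ω} (hS : IsBlockSet Γ.toSimpleGraphInclusive S)
    (hT : IsBlockSet Γ.toSimpleGraphInclusive T) {x y x' y' : Ω} (hx : x ∈ S) (hy : y ∈ S)
    (hx' : x' ∈ T) (hy' : y' ∈ T) (hxy : Γ.Adj x y) (hxy' : Γ.Adj x' y') :
    ∃ g ∈ G, g '' S = T ∧ g x = x' ∧ g y = y' := by
  obtain ⟨g, hg, rfl, rfl⟩ := h.exists_of_adj hxy hxy'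
  exact ⟨g, hg, (h.isBlockSet_image hg hS).eq_of_mem hT ⟨x, hx, rfl⟩ ⟨y, hy, rfl⟩ hx' hy'
    (h.ne_of_adj hc hxy'), rfl, rfl⟩

theorem even_length_iff_of_alternating {V : Type*} {A : SimpleGraph V} {S : Set V} {f : V → Prop}
    (hf : ∀ x ∈ S, ∀ y ∈ S, A.Adj x y → (f x ↔ ¬ f y)) {u v : V} (p : A.Walk u v)
    (hp : ∀ z ∈ p.support, z ∈ S) : Even p.length ↔ (f u ↔ f v) := by
  induction p with
  | nil => simp
  | @cons u v w h p ih =>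
    have h1 := ih fun z hz => hp z (by simp [hz])
    have h2 := hf u (hp u (by simp)) v (hp v (by simp)) h
    rw [SimpleGraph.Walk.length_cons, Nat.even_add_one, h1]
    tauto

/-- A graph in which paths between adjacent vertices have odd length has no odd closed walk. -/
theorem even_length_of_odd_paths {V : Type*} {A : SimpleGraph V}
    (h : ∀ u v (p : A.Walk u v), A.Adj u v → p.IsPath → Odd p.length) {u : V} (w : A.Walk u u) :
    Even w.length := by
  classical
  have key : ∀ {u v : V} (p : A.Walk u v), Even p.length ↔ Even p.bypass.length := by
    intro u v p
    induction p with
    | nil => simp [SimpleGraph.Walk.bypass]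
    | @cons a b c hab p ih =>
      rw [SimpleGraph.Walk.length_cons, Nat.even_add_one, ih, SimpleGraph.Walk.bypass]
      split_ifs with hs
      -- The discarded piece is the edge `ab` followed by a path from `b` back to `a`, odd by
      -- hypothesis, so parity is unchanged.
      · have h1 := h b a (p.bypass.takeUntil a hs) hab.symm (p.bypass_isPath.takeUntil hs)
        have h2 := congrArg SimpleGraph.Walk.length (p.bypass.take_spec hs)
        rw [SimpleGraph.Walk.length_append] at h2
        rw [← h2, Nat.even_add, ← Nat.not_odd_iff_even (n := SimpleGraph.Walk.length _)]
        tauto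
      · rw [SimpleGraph.Walk.length_cons, Nat.even_add_one]
  rw [key, (SimpleGraph.Walk.isPath_iff_nil.1 w.bypass_isPath).eq_nil]
  simp

/-- If no vertex is both the head of an arc and the tail of an arc of the same block, then the
digraph is bipartite. -/
theorem colorable_two_of_heads_and_tails
    (h : ∀ S, IsBlockSet Γ.toSimpleGraphInclusive S → ∀ v ∈ S, ∀ a ∈ S, ∀ b ∈ S,
      Γ.Adj v a → Γ.Adj b v → False) : Γ.toSimpleGraphInclusive.Colorable 2 := by
  rw [SimpleGraph.two_colorable_iff_forall_loop_even]
  refine fun _ w => even_length_of_odd_paths (fun u v p huv hp => ?_) w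
  obtain ⟨S, hS, hu, hv⟩ := exists_isBlockSet_of_adj huv
  -- Tails and heads of arcs in `S` alternate along any path that stays in `S`.
  let f : Ω → Prop := fun x => ∃ y ∈ S, Γ.Adj x y
  have hf : ∀ x ∈ S, ∀ y ∈ S, Γ.toSimpleGraphInclusive.Adj x y → (f x ↔ ¬ f y) := by
    rintro x hx y hy ⟨-, hxy | hxy⟩
    · exact iff_of_true ⟨y, hy, hxy⟩ fun ⟨z, hz, hyz⟩ => h S hS y hy z hz x hx hyz hxy
    · exact iff_of_false (fun ⟨z, hz, hxz⟩ => h S hS x hx z hz y hy hxz hxy)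
        (not_not.2 ⟨x, hx, hxy⟩)
  rw [← Nat.not_even_iff_odd, even_length_iff_of_alternating hf p (hS.support_subset hu hv p hp)]
  exact fun e => iff_not_self (e.symm.trans (hf u hu v hv huv))

/-- Connectedness makes the bipartition unique, hence `G`-invariant. By primitivity its two classes,
neither being all of `Ω`, have at most one element each. -/
theorem not_colorable_two_of_isPreprimitive [Infinite Ω] (hprim : MulAction.IsPreprimitive G Ω)
    (h : IsOrbitalDigraph G Γ) (hc : IsConnected Γ) :
    ¬ Γ.toSimpleGraphInclusive.Colorable 2 := by
  rintro hcol
  obtain ⟨c⟩ : Nonempty (Γ.toSimpleGraphInclusive.Coloring Bool) :=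
    ⟨hcol.toColoring (by simp)⟩
  have inv : ∀ g : G, ∀ x y, c (g⁻¹ • x) = c (g⁻¹ • y) ↔ c x = c y := by
    intro g x y
    obtain ⟨φ, hφ⟩ := h.exists_iso (G.inv_mem g.2)
    obtain ⟨p⟩ := hc.preconnected x y
    have h1 := c.even_length_iff_congr p
    have h2 := c.even_length_iff_congr (p.map φ.toHom)
    rw [SimpleGraph.Walk.length_map, h1] at h2
    rw [Bool.eq_iff_iff, Bool.eq_iff_iff (a := c x), h2]
    change _ ↔ (c (φ x) = true ↔ c (φ y) = true)
    rw [hφ, hφ]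
    rfl
  have triv : ∀ b, MulAction.IsTrivialBlock {x | c x = b} := by
    intro b
    refine hprim.isTrivialBlock_of_isBlock
      (MulAction.isBlock_iff_smul_eq_smul_of_nonempty.2 fun g k => ?_)
    rintro ⟨y, hy1, hy2⟩
    rw [Set.mem_smul_set_iff_inv_smul_mem] at hy1 hy2
    ext z
    rw [Set.mem_smul_set_iff_inv_smul_mem, Set.mem_smul_set_iff_inv_smul_mem]
    change c _ = b at hy1 hy2
    change c _ = b ↔ c _ = b
    rw [← hy1, inv g, hy1, ← hy2, inv k]
  have nuniv : ∀ b, {x | c x = b} ≠ Set.univ := by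
    intro b hb
    obtain ⟨x⟩ := hc.nonempty
    obtain ⟨w, hw⟩ := hc.preconnected.exists_adj_of_nontrivial x
    have hx : x ∈ {x | c x = b} := hb ▸ trivial
    have hw' : w ∈ {x | c x = b} := hb ▸ trivial
    exact c.valid hw (hx.trans hw'.symm)
  have fin : ∀ b, {x | c x = b}.Finite := fun b => ((triv b).resolve_right (nuniv b)).finite
  refine Set.infinite_univ (α := Ω) (((fin true).union (fin false)).subset fun x _ => ?_)
  cases hx : c x
  · exact Or.inr hx
  · exact Or.inl hx

/-- The setwise stabiliser of a block acts transitively on the block. -/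
theorem exists_image_eq_self [Infinite Ω] (hprim : MulAction.IsPreprimitive G Ω)
    (h : IsOrbitalDigraph G Γ) (hc : IsConnected Γ) {S : Set Ω}
    (hS : IsBlockSet Γ.toSimpleGraphInclusive S) {x y : Ω} (hx : x ∈ S) (hy : y ∈ S) :
    ∃ g ∈ G, g '' S = S ∧ g x = y := by
  -- With `v` both a tail and a head in `S`, an arc of `S` at any vertex of `S` can be carried to an
  -- arc at `v` of matching direction. If `S` has no such `v`, neither does any other block, and `Γ`
  -- would be bipartite.
  obtain ⟨v, hv, a, ha, b, hb, hva, hbv⟩ : ∃ v ∈ S, ∃ a ∈ S, ∃ b ∈ S, Γ.Adj v a ∧ Γ.Adj b v := by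
    by_contra hno
    push Not at hno
    refine not_colorable_two_of_isPreprimitive hprim h hc
      (colorable_two_of_heads_and_tails fun T hT v hv a ha b hb hva hbv => ?_)
    obtain ⟨w, hw, hxw⟩ := hS.exists_adj hc hx
    obtain ⟨s, hs, t, ht, hst⟩ : ∃ s ∈ S, ∃ t ∈ S, Γ.Adj s t := by
      rcases hxw.2 with hxw | hxw
      · exact ⟨x, hx, w, hw, hxw⟩
      · exact ⟨w, hw, x, hx, hxw⟩
    obtain ⟨g, hg, rfl, -, -⟩ := h.exists_image_eq hc hT hS hv ha hs ht hva hst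
    exact hno _ ⟨v, hv, rfl⟩ _ ⟨a, ha, rfl⟩ _ ⟨b, hb, rfl⟩ (h.adj_apply hg hva)
      (h.adj_apply hg hbv)
  have tov : ∀ x ∈ S, ∃ g ∈ G, g '' S = S ∧ g x = v := by
    intro x hx
    obtain ⟨w, hw, -, hxw | hxw⟩ := hS.exists_adj hc hx
    · obtain ⟨g, hg, h1, h2, -⟩ := h.exists_image_eq hc hS hS hx hw hv ha hxw hva
      exact ⟨g, hg, h1, h2⟩
    · obtain ⟨g, hg, h1, -, h2⟩ := h.exists_image_eq hc hS hS hw hx hb hv hxw hbv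
      exact ⟨g, hg, h1, h2⟩
  obtain ⟨g, hg, hgS, hgx⟩ := tov x hx
  obtain ⟨k, hk, hkS, hky⟩ := tov y hy
  refine ⟨k⁻¹ * g, G.mul_mem (G.inv_mem hk) hg, ?_, ?_⟩
  · rw [Equiv.Perm.coe_mul, Set.image_comp, hgS]
    conv_lhs => rw [← hkS]
    rw [← Set.image_comp, ← Equiv.Perm.coe_mul]
    simp
  · rw [Equiv.Perm.mul_apply, hgx, ← hky]
    simp

/-- The stabiliser of a vertex permutes the blocks containing it transitively. -/
theorem exists_image_eq_of_mem [Infinite Ω] (hprim : MulAction.IsPreprimitive G Ω)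
    (h : IsOrbitalDigraph G Γ) (hc : IsConnected Γ) {S T : Set Ω}
    (hS : IsBlockSet Γ.toSimpleGraphInclusive S) (hT : IsBlockSet Γ.toSimpleGraphInclusive T)
    {u : Ω} (huS : u ∈ S) (huT : u ∈ T) : ∃ g ∈ G, g '' S = T ∧ g u = u := by
  have arc : ∀ R, IsBlockSet Γ.toSimpleGraphInclusive R → u ∈ R →
      ∃ s ∈ R, ∃ t ∈ R, Γ.Adj s t := by
    intro R hR hu
    obtain ⟨w, hw, -, hxw | hxw⟩ := hR.exists_adj hc hu
    · exact ⟨u, hu, w, hw, hxw⟩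
    · exact ⟨w, hw, u, hu, hxw⟩
  obtain ⟨a, ha, b, hb, hab⟩ := arc S hS huS
  obtain ⟨a', ha', b', hb', hab'⟩ := arc T hT huT
  obtain ⟨g, hg, rfl, -, -⟩ := h.exists_image_eq hc hS hT ha hb ha' hb' hab hab'
  obtain ⟨k, hk, hkT, hku⟩ := exists_image_eq_self hprim h hc hT ⟨u, huS, rfl⟩ huT
  exact ⟨k * g, G.mul_mem hk hg, by rw [Equiv.Perm.coe_mul, Set.image_comp, hkT], hku⟩

end Orbital

/-! ### Comparing two canonical orbital digraphs. -/

section Comparison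

variable {Ω : Type*} {G : Subgroup (Equiv.Perm Ω)} {Γ₁ Γ₂ : Digraph Ω}

/-- The elements taking `v` to `c` form a coset of the stabiliser of `v`, so these images form a
translate of one of its orbits. -/
theorem NoInfiniteSubdegree.finite_image (hsub : NoInfiniteSubdegree G) (v a c : Ω) :
    {z | ∃ g ∈ G, g v = c ∧ g a = z}.Finite := by
  by_cases hne : ∃ k ∈ G, k v = c
  · obtain ⟨k, hk, rfl⟩ := hne
    refine ((hsub v a).image k).subset ?_
    rintro _ ⟨g, hg, hgv, rfl⟩
    refine ⟨k⁻¹ (g a), ⟨⟨⟨k⁻¹ * g, G.mul_mem (G.inv_mem hk) hg⟩, ?_⟩, rfl⟩, by simp⟩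
    change k⁻¹ (g v) = v
    simp [hgv]
  · exact Set.finite_empty.subset fun _ ⟨g, hg, hgv, _⟩ => hne ⟨g, hg, hgv⟩

/-- Only finitely many edges of an orbital digraph cross between different components of the
complement of a vertex in another connected orbital digraph. -/
theorem finite_crossing (hsub : NoInfiniteSubdegree G) (h₁ : IsOrbitalDigraph G Γ₁)
    (hc₁ : IsConnected Γ₁) (h₂ : IsOrbitalDigraph G Γ₂) (c : Ω) :
    {z | ∃ w, Γ₂.toSimpleGraphInclusive.Adj z w ∧
      ¬ JoinedOff Γ₁.toSimpleGraphInclusive c z w}.Finite := by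
  obtain ⟨α, β, rfl⟩ := h₂
  obtain ⟨p⟩ := hc₁.preconnected α β
  -- The translate of `p` by `g` is a walk of `Γ₁` between the ends of the crossing edge, so it must
  -- pass through `c`.
  have key : ∀ g ∈ G, ¬ JoinedOff Γ₁.toSimpleGraphInclusive c (g α) (g β) →
      ∃ v ∈ p.support, g v = c := by
    intro g hg hn
    by_contra hno
    push Not at hno
    have hj : JoinedOff Γ₁.toSimpleGraphInclusive (g⁻¹ c) α β :=
      ⟨p, fun hm => hno _ hm (by simp)⟩
    exact hn (by simpa using h₁.joinedOff_apply hg hj)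
  have hfin : (⋃ v ∈ {v | v ∈ p.support}, ({z | ∃ g ∈ G, g v = c ∧ g α = z} ∪
      {z | ∃ g ∈ G, g v = c ∧ g β = z})).Finite :=
    (List.finite_toSet p.support).biUnion fun v _ =>
      (hsub.finite_image v α c).union (hsub.finite_image v β c)
  refine hfin.subset ?_
  rintro z ⟨w, ⟨-, ⟨g, hg, rfl, rfl⟩ | ⟨g, hg, rfl, rfl⟩⟩, hn⟩
  · obtain ⟨v, hv, hgv⟩ := key g hg hn
    exact Set.mem_biUnion hv (Or.inl ⟨g, hg, hgv, rfl⟩)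
  · obtain ⟨v, hv, hgv⟩ := key g hg fun hj => hn hj.symm
    exact Set.mem_biUnion hv (Or.inr ⟨g, hg, hgv, rfl⟩)

/-- All but finitely many vertices of a block of `Γ₂` lie in one component of `Γ₁` off `c`. -/
theorem exists_finite_not_joinedOff (hsub : NoInfiniteSubdegree G)
    (h₁ : IsCanonicalOrbitalDigraph G Γ₁) (h₂ : IsCanonicalOrbitalDigraph G Γ₂) {S : Set Ω}
    (hS : IsBlockSet Γ₂.toSimpleGraphInclusive S) {c : Ω} :
    ∃ z, z ≠ c ∧ {x ∈ S | ¬ JoinedOff Γ₁.toSimpleGraphInclusive c z x}.Finite := by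
  by_cases hfin : S.Finite
  · obtain ⟨z, -, hz⟩ := hS.1.1.exists_ne c
    exact ⟨z, hz, hfin.subset fun x hx => hx.1⟩
  -- Each component off `c` contains one of the finitely many neighbours of `c`, so one component
  -- has infinitely many vertices of `S`.
  obtain ⟨n, hn, hinf⟩ : ∃ n, n ≠ c ∧
      {x ∈ S | JoinedOff Γ₁.toSimpleGraphInclusive c n x}.Infinite := by
    by_contra hno
    push Not at hno
    refine hfin (((Set.finite_singleton c).union ((h₁.locallyFinite c).biUnion fun n hn =>
      hno n (show Γ₁.toSimpleGraphInclusive.Adj c n from hn).ne')).subset fun x hx => ?_)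
    by_cases hxc : x = c
    · exact Or.inl hxc
    · obtain ⟨n, hn, hj⟩ := exists_adj_joinedOff h₁.connected hxc
      exact Or.inr (Set.mem_biUnion hn ⟨hx, hj⟩)
  refine ⟨n, hn, ?_⟩
  have hE : AtMostOneEnd (inducedOn Γ₂ S) := h₂.lobe_ends S ((isLobe_iff h₂.connected S).2 hS)
  have hcS : IsConnected (inducedOn Γ₂ S) := by
    rw [IsConnected, inducedOn_toSimpleGraphInclusive]
    exact hS.induce_connected h₂.connected
  have hfS : IsLocallyFinite (inducedOn Γ₂ S) := by
    intro v
    rw [inducedOn_toSimpleGraphInclusive]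
    exact Set.Finite.preimage Subtype.val_injective.injOn (h₂.locallyFinite v)
  have hX := hE.finite_or_finite_compl hcS hfS
    (X := {x : S | JoinedOff Γ₁.toSimpleGraphInclusive c n x}) (by
      refine ((finite_crossing hsub h₁.orbital h₁.connected h₂.orbital c).preimage
        Subtype.val_injective.injOn).subset ?_
      rintro x ⟨w, hw, hadj⟩
      rw [inducedOn_toSimpleGraphInclusive] at hadj
      refine ⟨w, hadj, fun hj => ?_⟩
      have h1 : JoinedOff Γ₁.toSimpleGraphInclusive c n x ↔
          ¬ JoinedOff Γ₁.toSimpleGraphInclusive c n w := hw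
      have h2 : JoinedOff Γ₁.toSimpleGraphInclusive c n x ↔
          JoinedOff Γ₁.toSimpleGraphInclusive c n w :=
        ⟨fun h => h.trans hj, fun h => h.trans hj.symm⟩
      exact iff_not_self (h2.symm.trans h1))
  rcases hX with hX | hX
  · refine absurd ((hX.image Subtype.val).subset ?_) hinf
    rintro x ⟨hx, hj⟩
    exact ⟨⟨x, hx⟩, hj, rfl⟩
  · refine (hX.image Subtype.val).subset ?_
    rintro x ⟨hx, hj⟩
    exact ⟨⟨x, hx⟩, hj, rfl⟩

/-- A vertex of a block of `Γ₂` does not separate, in `Γ₁`, two other vertices of that block. -/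
theorem joinedOff_of_mem_block [Infinite Ω] (hprim : MulAction.IsPreprimitive G Ω)
    (hsub : NoInfiniteSubdegree G) (h₁ : IsCanonicalOrbitalDigraph G Γ₁)
    (h₂ : IsCanonicalOrbitalDigraph G Γ₂) {S : Set Ω}
    (hS : IsBlockSet Γ₂.toSimpleGraphInclusive S) {c x y : Ω} (hc : c ∈ S) (hx : x ∈ S)
    (hy : y ∈ S) (hxc : x ≠ c) (hyc : y ≠ c) :
    JoinedOff Γ₁.toSimpleGraphInclusive c x y := by
  let A := Γ₁.toSimpleGraphInclusive
  suffices key : ∀ k z, z ≠ c → {x ∈ S | ¬ JoinedOff A c z x}.Finite →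
      {x ∈ S | ¬ JoinedOff A c z x}.ncard = k →
      ∃ z', ∀ x ∈ S, x ≠ c → JoinedOff A c z' x by
    obtain ⟨z, hz, hfin⟩ := exists_finite_not_joinedOff hsub h₁ h₂ hS (c := c)
    obtain ⟨z', hz'⟩ := key _ z hz hfin rfl
    exact (hz' x hx hxc).symm.trans (hz' y hy hyc)
  intro k
  induction k using Nat.strong_induction_on with
  | _ k ih =>
    intro z hz hfin hk
    by_cases hall : ∀ x ∈ S, x ≠ c → JoinedOff A c z x
    · exact ⟨z, hall⟩
    push Not at hall
    obtain ⟨v, hv, hvc, hnj⟩ := hall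
    -- What `v` cuts off from `c` was already cut off by `c` from `z`; the inclusion is strict
    -- because `c` lies only in the larger set. Moving `v` to `c` inside `S` then continues the
    -- descent with base point `g c`.
    have hssub : {x ∈ S | ¬ JoinedOff A v c x} ⊂ {x ∈ S | ¬ JoinedOff A c z x} := by
      refine ⟨fun x hx => ⟨hx.1, fun hj => hx.2 ?_⟩, fun hsub' => ?_⟩
      · exact JoinedOff.exchange h₁.connected hvc
          fun h => hnj (hj.trans h.symm)
      · exact (hsub' ⟨hc, fun hj => hj.ne_right rfl⟩).2 (.refl hvc.symm)
    obtain ⟨g, hg, hgS, hgv⟩ := exists_image_eq_self hprim h₂.orbital h₂.connected hS hv hc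
    have himg : {x ∈ S | ¬ JoinedOff A c (g c) x} = g '' {x ∈ S | ¬ JoinedOff A v c x} := by
      ext w
      constructor
      · rintro ⟨hw, hn⟩
        obtain ⟨x, hx, rfl⟩ := hgS.symm.subset hw
        refine ⟨x, ⟨hx, fun hj => hn ?_⟩, rfl⟩
        have hj' := h₁.orbital.joinedOff_apply hg hj
        rwa [hgv] at hj'
      · rintro ⟨x, ⟨hx, hn⟩, rfl⟩
        refine ⟨hgS.subset ⟨x, hx, rfl⟩, fun hj => hn ?_⟩
        have hj' := h₁.orbital.joinedOff_apply (G.inv_mem hg) hj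
        have hk : ∀ z, g⁻¹ (g z) = z := by simp
        rwa [Equiv.Perm.inv_eq_iff_eq.2 hgv.symm, hk, hk] at hj'
    refine ih _ ?_ (g c) ?_ ?_ rfl
    · rw [himg, Set.ncard_image_of_injective _ g.injective, ← hk]
      exact Set.ncard_lt_ncard hssub hfin
    · exact fun h => hvc (g.injective (hgv.trans h.symm))
    · rw [himg]
      exact (hfin.subset hssub.1).image g

theorem exists_block_joinedOff {A : SimpleGraph Ω} (hA : A.Connected) {u x : Ω} (h : x ≠ u) :
    ∃ T, IsBlockSet A T ∧ u ∈ T ∧ ∃ n ∈ T, JoinedOff A u n x := by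
  obtain ⟨n, hn, hj⟩ := exists_adj_joinedOff hA h
  obtain ⟨T, hT, hu, hnT⟩ := exists_isBlockSet_of_adj hn
  exact ⟨T, hT, hu, n, hnT, hj⟩

/-- There is a surjection from the blocks of `Γ₂` at `u` to those of `Γ₁` at `u` that sends a block
to the one lying in the same component of `Γ₁` off `u`. -/
theorem exists_surjective_blocks [Infinite Ω] (hprim : MulAction.IsPreprimitive G Ω)
    (hsub : NoInfiniteSubdegree G) (h₁ : IsCanonicalOrbitalDigraph G Γ₁)
    (h₂ : IsCanonicalOrbitalDigraph G Γ₂) (u : Ω) :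
    ∃ f : {T | IsBlockSet Γ₂.toSimpleGraphInclusive T ∧ u ∈ T} →
        {T | IsBlockSet Γ₁.toSimpleGraphInclusive T ∧ u ∈ T},
      Function.Surjective f ∧ ∀ M, ∀ x ∈ M.1, x ≠ u → ∀ y ∈ (f M).1, y ≠ u →
        JoinedOff Γ₁.toSimpleGraphInclusive u x y := by
  have hex : ∀ M : {T | IsBlockSet Γ₂.toSimpleGraphInclusive T ∧ u ∈ T},
      ∃ L : {T | IsBlockSet Γ₁.toSimpleGraphInclusive T ∧ u ∈ T},
        ∀ x ∈ M.1, x ≠ u → ∀ y ∈ L.1, y ≠ u → JoinedOff Γ₁.toSimpleGraphInclusive u x y := by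
    rintro ⟨M, hM, hu⟩
    obtain ⟨x, hx, hxu⟩ := hM.1.1.exists_ne u
    obtain ⟨T, hT, huT, n, hn, hj⟩ := exists_block_joinedOff h₁.connected hxu
    exact ⟨⟨T, hT, huT⟩, fun x' hx' hxu' y hy hyu =>
      ((joinedOff_of_mem_block hprim hsub h₁ h₂ hM hu hx' hx hxu' hxu).trans hj.symm).trans
        (hT.1.2 hn hy hj.ne_left hyu)⟩
  choose f hf using hex
  refine ⟨f, ?_, hf⟩
  rintro ⟨L, hL, huL⟩
  obtain ⟨w, hw⟩ := exists_ne u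
  obtain ⟨M, hM, huM, -⟩ := exists_block_joinedOff h₂.connected hw
  -- The map commutes with the stabiliser of `u`, so its image, being nonempty, is everything.
  obtain ⟨g, hg, hgL, hgu⟩ := exists_image_eq_of_mem hprim h₁.orbital h₁.connected
    (f ⟨M, hM, huM⟩).2.1 hL (f ⟨M, hM, huM⟩).2.2 huL
  have hgM := h₂.orbital.isBlockSet_image hg hM
  refine ⟨⟨g '' M, hgM, u, huM, hgu⟩, Subtype.ext ?_⟩
  obtain ⟨x, hx, hxu⟩ := hM.1.1.exists_ne u
  obtain ⟨y, hy, hyu⟩ := (f ⟨M, hM, huM⟩).2.1.1.1.exists_ne u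
  have hgne : ∀ z, z ≠ u → g z ≠ u := fun z hz h => hz (g.injective (h.trans hgu.symm))
  set N := f ⟨g '' M, hgM, u, huM, hgu⟩ 
  obtain ⟨y', hy', hyu'⟩ := N.2.1.1.1.exists_ne u
  have h1 : JoinedOff Γ₁.toSimpleGraphInclusive u (g x) (g y) := by
    have := h₁.orbital.joinedOff_apply hg (hf ⟨M, hM, huM⟩ x hx hxu y hy hyu)
    rwa [hgu] at this
  have h2 := hf ⟨g '' M, hgM, u, huM, hgu⟩ (g x) ⟨x, hx, rfl⟩ (hgne x hxu) y' hy' hyu'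
  exact N.2.1.eq_of_joinedOff hL N.2.2 huL hy' (hgL.subset ⟨y, hy, rfl⟩) (h2.symm.trans h1)

/-- Different blocks of `Γ₂` at `u` lie in different components of `Γ₁` off `u`. -/
theorem block_eq_of_joinedOff [Infinite Ω] (hprim : MulAction.IsPreprimitive G Ω)
    (hsub : NoInfiniteSubdegree G) (h₁ : IsCanonicalOrbitalDigraph G Γ₁)
    (h₂ : IsCanonicalOrbitalDigraph G Γ₂) {S T : Set Ω}
    (hS : IsBlockSet Γ₂.toSimpleGraphInclusive S) (hT : IsBlockSet Γ₂.toSimpleGraphInclusive T)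
    {u x y : Ω} (huS : u ∈ S) (huT : u ∈ T) (hx : x ∈ S) (hy : y ∈ T)
    (hj : JoinedOff Γ₁.toSimpleGraphInclusive u x y) : S = T := by
  obtain ⟨f, hf, hfj⟩ := exists_surjective_blocks hprim hsub h₁ h₂ u
  obtain ⟨f', hf', -⟩ := exists_surjective_blocks hprim hsub h₂ h₁ u
  have := (finite_isBlockSet_mem h₂.connected (h₂.locallyFinite u)).to_subtype
  -- `f' ∘ f` is a surjective self-map of a finite set.
  have hinj : Function.Injective f :=
    (Finite.injective_iff_surjective.2 (hf'.comp hf)).of_comp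
  refine congrArg Subtype.val (@hinj ⟨S, hS, huS⟩ ⟨T, hT, huT⟩ (Subtype.ext ?_))
  obtain ⟨a, ha, hau⟩ := (f ⟨S, hS, huS⟩).2.1.1.1.exists_ne u
  obtain ⟨b, hb, hbu⟩ := (f ⟨T, hT, huT⟩).2.1.1.1.exists_ne u
  exact (f ⟨S, hS, huS⟩).2.1.eq_of_joinedOff (f ⟨T, hT, huT⟩).2.1 (f ⟨S, hS, huS⟩).2.2
    (f ⟨T, hT, huT⟩).2.2 ha hb
    (((hfj ⟨S, hS, huS⟩ x hx hj.ne_left a ha hau).symm.trans hj).trans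
      (hfj ⟨T, hT, huT⟩ y hy hj.ne_right b hb hbu))

theorem dist_add_dist_of_not_joinedOff {A : SimpleGraph Ω} (hA : A.Connected) {u v x : Ω}
    (h : ¬ JoinedOff A v u x) : A.dist u v + A.dist v x = A.dist u x := by
  classical
  obtain ⟨p, hp⟩ := (hA u x).exists_walk_length_eq_dist
  have hvp : v ∈ p.support := by
    by_contra hvp
    exact h ⟨p, hvp⟩
  have h1 := congrArg SimpleGraph.Walk.length (p.take_spec hvp)
  rw [SimpleGraph.Walk.length_append, hp] at h1
  have h2 := SimpleGraph.dist_le (p.takeUntil v hvp)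
  have h3 := SimpleGraph.dist_le (p.dropUntil v hvp)
  have h4 : A.dist u x ≤ A.dist u v + A.dist v x := hA.dist_triangle
  omega

/-- Vertices separated by `u` in `Γ₂` are separated by `u` in `Γ₁`. -/
theorem JoinedOff.of_canonical [Infinite Ω] (hprim : MulAction.IsPreprimitive G Ω)
    (hsub : NoInfiniteSubdegree G) (h₁ : IsCanonicalOrbitalDigraph G Γ₁)
    (h₂ : IsCanonicalOrbitalDigraph G Γ₂) {u x y : Ω}
    (hj : JoinedOff Γ₁.toSimpleGraphInclusive u x y) :
    JoinedOff Γ₂.toSimpleGraphInclusive u x y := by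
  let A := Γ₁.toSimpleGraphInclusive
  let B := Γ₂.toSimpleGraphInclusive
  have hBc : B.Connected := h₂.connected
  have hAc : A.Connected := h₁.connected
  suffices key : ∀ n u x y, B.dist u x + B.dist u y = n → x ≠ u → y ≠ u →
      ¬ JoinedOff B u x y → ¬ JoinedOff A u x y by
    by_contra hn
    exact key _ u x y rfl hj.ne_left hj.ne_right hn hj
  clear hj u x y
  intro n
  induction n using Nat.strong_induction_on with
  | _ n ih =>
    -- If `v` separates `u` from `x` in `Γ₂`, it lies on a geodesic between them. Both `v` with the
    -- pair `u, x` and `u` with the pair `v, y` then have smaller distance sum, and `v`, `x` are on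
    -- the same side of `u` in both graphs.
    have move : ∀ u x y, B.dist u x + B.dist u y = n → x ≠ u → y ≠ u → ¬ JoinedOff B u x y →
        ∀ v, v ≠ u → v ≠ x → ¬ JoinedOff B v u x → ¬ JoinedOff A u x y := by
      intro u x y hn hxu hyu hxy v hvu hvx hv hj
      have hd := dist_add_dist_of_not_joinedOff hBc hv
      have h1 : 0 < B.dist v x := hBc.pos_dist_of_ne hvx
      have h2 : 0 < B.dist u y := hBc.pos_dist_of_ne hyu.symm
      have hB' : JoinedOff B u v x := .exchange hBc hvu.symm hv
      have h3 : B.dist v u = B.dist u v := SimpleGraph.dist_comm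
      have hA' : ¬ JoinedOff A v u x := ih _ (by omega) v u x rfl hvu.symm hvx.symm hv
      have hA'' : JoinedOff A u v x := .exchange hAc hvu.symm hA'
      exact ih _ (by omega) u v y rfl hvu hyu (fun h => hxy (hB'.symm.trans h)) (hA''.trans hj)
    intro u x y hn hxu hyu hxy hj
    by_cases hx : ∀ v, u ≠ v → x ≠ v → JoinedOff B v u x
    · by_cases hy : ∀ v, u ≠ v → y ≠ v → JoinedOff B v u y
      -- No vertex is left to move to: `x` and `y` each share a block of `Γ₂` with `u`.
      · obtain ⟨S, hS, huS, hxS⟩ := exists_isBlockSet hxu.symm hx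
        obtain ⟨T, hT, huT, hyT⟩ := exists_isBlockSet hyu.symm hy
        obtain rfl := block_eq_of_joinedOff hprim hsub h₁ h₂ hS hT huS huT hxS hyT hj
        exact hxy (hS.1.2 hxS hyT hxu hyu)
      · push Not at hy
        obtain ⟨v, hvu, hvy, hv⟩ := hy
        exact move u y x (by omega) hyu hxu (fun h => hxy h.symm) v hvu.symm hvy.symm hv hj.symm
    · push Not at hx
      obtain ⟨v, hvu, hvx, hv⟩ := hx
      exact move u x y hn hxu hyu hxy v hvu.symm hvx.symm hv hj

theorem isLobe_iff_isLobe [Infinite Ω] (hprim : MulAction.IsPreprimitive G Ω)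
    (hsub : NoInfiniteSubdegree G) (h₁ : IsCanonicalOrbitalDigraph G Γ₁)
    (h₂ : IsCanonicalOrbitalDigraph G Γ₂) (S : Set Ω) : IsLobe Γ₁ S ↔ IsLobe Γ₂ S := by
  have hI : ∀ T : Set Ω, Inseparable Γ₁.toSimpleGraphInclusive T ↔
      Inseparable Γ₂.toSimpleGraphInclusive T := fun T =>
    ⟨fun h _ _ _ hx hy hxu hyu => (h hx hy hxu hyu).of_canonical hprim hsub h₁ h₂,
      fun h _ _ _ hx hy hxu hyu => (h hx hy hxu hyu).of_canonical hprim hsub h₂ h₁⟩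
  rw [isLobe_iff h₁.connected, isLobe_iff h₂.connected, IsBlockSet, IsBlockSet]
  simp only [hI]

/-- A canonical orbital digraph is of the form `Γ(m, Λ)`. -/
theorem IsCanonicalOrbitalDigraph.exists_hasForm [Infinite Ω]
    (hprim : MulAction.IsPreprimitive G Ω) {Γ : Digraph Ω}
    (h : IsCanonicalOrbitalDigraph G Γ) : ∃ (m : ℕ) (S : Set Ω), HasForm Γ m S := by
  obtain ⟨u⟩ := h.connected.nonempty
  obtain ⟨w, hw⟩ := exists_ne u
  obtain ⟨S, hS, -⟩ := exists_block_joinedOff h.connected hw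
  refine ⟨{T | IsLobe Γ T ∧ u ∈ T}.ncard, S, fun v => ?_, (isLobe_iff h.connected S).2 hS⟩
  simp only [isLobe_iff h.connected]
  rw [Set.Finite.cast_ncard_eq (finite_isBlockSet_mem h.connected (h.locallyFinite u))]
  have le : ∀ a b : Ω, {T | IsBlockSet Γ.toSimpleGraphInclusive T ∧ a ∈ T}.encard ≤
      {T | IsBlockSet Γ.toSimpleGraphInclusive T ∧ b ∈ T}.encard := by
    intro a b
    obtain ⟨⟨g, hg⟩, hgab⟩ := hprim.exists_smul_eq a b
    refine Set.encard_le_encard_of_injOn (f := fun T => g '' T) (fun T hT => ?_)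
      (g.injective.image_injective.injOn)
    exact ⟨h.orbital.isBlockSet_image hg hT.1, a, hT.2, hgab⟩
  exact le_antisymm (le v u) (le u v)

end Comparison

end PermDigraph

theorem mainTheorem3 {Ω : Type*} [Infinite Ω] (G : Subgroup (Equiv.Perm Ω))
    (hprim : MulAction.IsPreprimitive G Ω) (hsub : PermDigraph.NoInfiniteSubdegree G)
    (Γ₁ Γ₂ : Digraph Ω) (h₁ : PermDigraph.IsCanonicalOrbitalDigraph G Γ₁)
    (h₂ : PermDigraph.IsCanonicalOrbitalDigraph G Γ₂) :
    PermDigraph.Equivalent Γ₁ Γ₂ := by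
  refine ⟨h₁.exists_hasForm hprim, fun m S => ?_⟩
  simp only [PermDigraph.HasForm, PermDigraph.isLobe_iff_isLobe hprim hsub h₁ h₂]
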